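/- Let $n,N\in\mathbb{N}$ and let $\Omega\subset\mathbb{R}^{n}$ be a simply connected bounded Lipschitz domain, that is, a bounded, connected and simply connected open set such that, near each of its boundary points and after a rotation of the coordinate axes, $\Omega$ coincides with the set of points lying strictly above the graph of a Lipschitz function of $n-1$ variables. Let $E=(E^\alpha_i)\in \mathrm{L}^{1}(\Omega;\mathbb{R}^{N\times n})$ be curl-free in the sense of distributions on $\Omega$, that is, $$\int_\Omega \big(E^\alpha_i\,\partial_j\varphi-E^\alpha_j\,\partial_i\varphi\big)\,\mathrm{d}x=0$$ for all $\alpha\in\{1,\dots,N\}$, all $i,j\in\{1,\dots,n\}$ and all $\varphi\in \mathrm{C}^1(\Omega)$ with compact support in $\Omega$. Then there exists a function $v\in \mathrm{W}^{1,1}(\Omega;\mathbb{R}^{N})$ whose weak gradient satisfies $\nabla v=E$ $\mathscr{L}^{n}$-a.e. in $\Omega$. -/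

import Mathlib

open MeasureTheory
open scoped ContDiff

namespace SobolevPoincare

/-- `Ω` is a bounded Lipschitz domain in `ℝⁿ`: a bounded, connected (in particular non-empty) open
set such that near each of its boundary points, after a rotation of the coordinate axes, `Ω` is the
part lying strictly above the graph of a Lipschitz function of `n - 1` variables.

The unit vector `e` is the direction of the last rotated axis, `inner ℝ e y` is the last rotated
coordinate of `y`, and `y - inner ℝ e y • e` is the orthogonal projection of `y` to the hyperplane
`e^⊥`, which carries the other coordinates; only the values of `g` on `e^⊥` matter. -/
structure IsBoundedLipschitzDomain {n : ℕ} (Ω : Set (EuclideanSpace ℝ (Fin n))) : Prop where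
  isOpen : IsOpen Ω
  isConnected : IsConnected Ω
  isBounded : Bornology.IsBounded Ω
  boundary : ∀ x₀ ∈ frontier Ω, ∃ r > (0 : ℝ), ∃ e : EuclideanSpace ℝ (Fin n), ‖e‖ = 1 ∧
    ∃ (K : NNReal) (g : EuclideanSpace ℝ (Fin n) → ℝ), LipschitzWith K g ∧
      ∀ y ∈ Metric.ball x₀ r, y ∈ Ω ↔ g (y - inner ℝ e y • e) < inner ℝ e y

/-- `φ` is a real test function of class `C^k` with compact support in `Ω`
(extended by zero to all of `ℝⁿ`). -/
structure IsTestFunction {n : ℕ} (k : ℕ∞) (Ω : Set (EuclideanSpace ℝ (Fin n)))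
    (φ : EuclideanSpace ℝ (Fin n) → ℝ) : Prop where
  contDiff : ContDiff ℝ k φ
  hasCompactSupport : HasCompactSupport φ
  tsupport_subset : tsupport φ ⊆ Ω

/-- The classical partial derivative `∂ᵢ φ (x)`. -/
noncomputable def partialDeriv {n : ℕ} (i : Fin n) (φ : EuclideanSpace ℝ (Fin n) → ℝ)
    (x : EuclideanSpace ℝ (Fin n)) : ℝ :=
  fderiv ℝ φ x (EuclideanSpace.single i 1)

/-- `E ∈ L¹(Ω; ℝ^{N × n})`: all entries of `E` are (Lebesgue measurable and) integrable on `Ω`. -/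
def MatrixIntegrableOn {n N : ℕ} (Ω : Set (EuclideanSpace ℝ (Fin n)))
    (E : EuclideanSpace ℝ (Fin n) → Matrix (Fin N) (Fin n) ℝ) : Prop :=
  ∀ (α : Fin N) (i : Fin n), IntegrableOn (fun x => E x α i) Ω volume

/-- A vector field `e` on `Ω` (meant to be integrable on `Ω`) is curl-free in the sense of
distributions: `∫_Ω (eᵢ ∂ⱼφ - eⱼ ∂ᵢφ) dx = 0` for all `φ ∈ C¹_c(Ω)` and all `i, j`. -/
def IsDistribCurlFree {n : ℕ} (Ω : Set (EuclideanSpace ℝ (Fin n)))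
    (e : EuclideanSpace ℝ (Fin n) → Fin n → ℝ) : Prop :=
  ∀ φ : EuclideanSpace ℝ (Fin n) → ℝ, IsTestFunction 1 Ω φ → ∀ i j : Fin n,
    ∫ x in Ω, (e x i * partialDeriv j φ x - e x j * partialDeriv i φ x) = 0

/-- A matrix field is curl-free in the sense of distributions if each of its rows is. -/
def IsMatrixDistribCurlFree {n N : ℕ} (Ω : Set (EuclideanSpace ℝ (Fin n)))
    (E : EuclideanSpace ℝ (Fin n) → Matrix (Fin N) (Fin n) ℝ) : Prop :=
  ∀ α : Fin N, IsDistribCurlFree Ω (fun x i => E x α i)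

/-- The matrix field `G` is a weak gradient of `v : Ω → ℝᴺ`, i.e. `G α i` is the weak partial
derivative `∂ᵢ v_α`: both are locally integrable on `Ω` and
`∫_Ω v_α ∂ᵢφ dx = - ∫_Ω G α i φ dx` for all `φ ∈ C^∞_c(Ω)`. -/
structure HasWeakGradient {n N : ℕ} (Ω : Set (EuclideanSpace ℝ (Fin n)))
    (v : EuclideanSpace ℝ (Fin n) → EuclideanSpace ℝ (Fin N))
    (G : EuclideanSpace ℝ (Fin n) → Matrix (Fin N) (Fin n) ℝ) : Prop where
  locallyIntegrableOn : LocallyIntegrableOn v Ω volume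
  locallyIntegrableOn_gradient : ∀ (α : Fin N) (i : Fin n),
    LocallyIntegrableOn (fun x => G x α i) Ω volume
  integral_eq : ∀ φ : EuclideanSpace ℝ (Fin n) → ℝ, IsTestFunction ⊤ Ω φ →
    ∀ (α : Fin N) (i : Fin n),
      ∫ x in Ω, v x α * partialDeriv i φ x = - ∫ x in Ω, G x α i * φ x

/-- `v ∈ W^{1,1}(Ω; ℝᴺ)`: `v` is integrable on `Ω` and has an integrable weak gradient on `Ω`. -/
def MemW11 {n N : ℕ} (Ω : Set (EuclideanSpace ℝ (Fin n)))
    (v : EuclideanSpace ℝ (Fin n) → EuclideanSpace ℝ (Fin N)) : Prop :=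
  IntegrableOn v Ω volume ∧
    ∃ G : EuclideanSpace ℝ (Fin n) → Matrix (Fin N) (Fin n) ℝ,
      MatrixIntegrableOn Ω G ∧ HasWeakGradient Ω v G

end SobolevPoincare

open SobolevPoincare

open Set Filter Topology Metric
open scoped Convolution Manifold

/-! Each row `e` of the field is treated separately. On a set star-shaped about `y`, the candidate
potential is Poincaré's v(x) = ∫₀¹ ∑ⱼ eⱼ(y + t(x - y)) (xⱼ - yⱼ) dt. For `e` merely in L¹ the
integral may diverge for a given centre, but averaging over a ball of centres yields a good one
(`exists_center_lintegral_lt_top`); hence the pieces are required to be star-shaped about every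
point of a ball. That ∇v = e is checked by duality: the curl condition makes the integral over t ∈
[s, 1] explicit (`intervalIntegral_radial`), and the boundary term at s → 0 vanishes because 1/s is
not integrable at 0.

The Lipschitz condition and compactness of the closure cover Ω by finitely many such pieces
(`exists_starConvex`). Two potentials differ on an overlap by a locally constant function, by
mollification. These differences form a Čech 1-cocycle, which is a coboundary since Ω is simply
connected, so the potentials can be shifted to agree. Finiteness of the cover gives integrability of
the glued function on all of Ω. -/

/-! ### Locally constant cocycles on simply connected spaces -/

theorem exists_primitive_of_locallyConstant_cocycle {X ι A : Type*} [TopologicalSpace X]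
    [SimplyConnectedSpace X] [LocallyPathConnectedSpace X] [AddCommGroup A]
    (U : ι → Set X) (hU : ∀ i, IsOpen (U i)) (hcov : ∀ x, ∃ i, x ∈ U i) (c : ι → ι → X → A)
    (hc : ∀ i j, ∀ x ∈ U i ∩ U j, ∀ᶠ y in 𝓝 x, c i j y = c i j x)
    (hcocycle : ∀ i j k, ∀ x ∈ U i ∩ U j ∩ U k, c i j x + c j k x = c i k x) :
    ∃ a : ι → X → A, (∀ i, ∀ x ∈ U i, ∀ᶠ y in 𝓝 x, a i y = a i x) ∧
      ∀ i j, ∀ x ∈ U i ∩ U j, a j x = a i x + c i j x := by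
  -- With `A` discrete, the translations by `c i j` glue the sets `U i × A` to a bundle with
  -- discrete fibre, that is, a covering of `X`.
  let _ : TopologicalSpace A := ⊥
  have : DiscreteTopology A := ⟨rfl⟩
  choose idx hidx using hcov
  have hself : ∀ i, ∀ x ∈ U i, c i i x = 0 := fun i x hx ↦ by
    simpa using hcocycle i i i x ⟨⟨hx, hx⟩, hx⟩
  let Z : FiberBundleCore ι X A :=
    { baseSet := U
      isOpen_baseSet := hU
      indexAt := idx
      mem_baseSet_at := hidx
      coordChange := fun i j x v ↦ v + c i j x
      coordChange_self := fun i x hx v ↦ by simp [hself i x hx]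
      continuousOn_coordChange := fun i j ↦ by
        rintro ⟨x, v⟩ ⟨hx, -⟩
        refine ContinuousAt.continuousWithinAt ?_
        have h1 : (fun p : X × A ↦ p.2 + c i j p.1) =ᶠ[𝓝 (x, v)] fun _ ↦ v + c i j x := by
          have h2 : ∀ᶠ w in 𝓝 v, w = v := by
            rw [nhds_discrete]; simp
          filter_upwards [(hc i j x hx).prod_nhds h2] with p hp
          rw [hp.1, hp.2]
        exact continuousAt_const.congr h1.symm
      coordChange_comp := fun i j k x hx v ↦ by rw [add_assoc, hcocycle i j k x hx] }
  have hcovering : IsCoveringMap (Bundle.TotalSpace.proj : Z.TotalSpace → X) :=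
    FiberBundle.isCoveringMap (F := A) (E := Z.Fiber)
  obtain ⟨x₀⟩ : Nonempty X := inferInstance
  -- Simple connectedness lifts the identity of `X` to a global section; its coordinate in the i-th
  -- trivialization is `a i`.
  obtain ⟨s, ⟨-, hs⟩, -⟩ := hcovering.existsUnique_continuousMap_lifts (ContinuousMap.id X) x₀
    (⟨x₀, (0 : A)⟩ : Z.TotalSpace) rfl
  have hproj : ∀ x, (s x).1 = x := fun x ↦ congrFun hs x
  refine ⟨fun i x ↦ ((Z.localTriv i) (s x)).2, fun i x hx ↦ ?_, fun i j x hx ↦ ?_⟩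
  · have h1 : ContinuousAt (fun y ↦ ((Z.localTriv i) (s y)).2) x := by
      refine continuous_snd.continuousAt.comp (ContinuousAt.comp ?_ s.continuous.continuousAt)
      refine (Z.localTriv i).continuousAt ?_
      rw [Z.mem_localTriv_source, hproj]
      exact hx
    have h2 := h1.tendsto
    rw [nhds_discrete A] at h2
    simpa using h2
  · let σ : X → A := fun x ↦ (s x).2
    have h1 : ∀ i, ((Z.localTriv i) (s x)).2 = σ x + c (idx x) i x := fun i ↦ by
      rw [Z.localTriv_apply]
      change σ x + c (idx (s x).1) i (s x).1 = _
      rw [hproj]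
    change ((Z.localTriv j) (s x)).2 = ((Z.localTriv i) (s x)).2 + c i j x
    rw [h1, h1, ← hcocycle (idx x) i j x ⟨⟨hidx x, hx.1⟩, hx.2⟩]
    exact (add_assoc (_ : A) _ _).symm

/-! ### Functions with vanishing weak gradient -/

theorem ContinuousLinearMap.eq_zero_of_apply_single {n : ℕ} {D : EuclideanSpace ℝ (Fin n) →L[ℝ] ℝ}
    (h : ∀ i, D (EuclideanSpace.single i 1) = 0) : D = 0 := by
  refine ContinuousLinearMap.coe_injective ((EuclideanSpace.basisFun (Fin n) ℝ).toBasis.ext ?_)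
  simpa using h

theorem partialDeriv_comp_sub_left {n : ℕ} (i : Fin n) {φ : EuclideanSpace ℝ (Fin n) → ℝ}
    (hφ : Differentiable ℝ φ) (x t : EuclideanSpace ℝ (Fin n)) :
    partialDeriv i (fun s ↦ φ (x - s)) t = -partialDeriv i φ (x - t) := by
  have h1 : HasFDerivAt (fun s ↦ φ (x - s))
      ((fderiv ℝ φ (x - t)).comp (-ContinuousLinearMap.id ℝ (EuclideanSpace ℝ (Fin n)))) t :=
    (hφ (x - t)).hasFDerivAt.comp t ((hasFDerivAt_id t).const_sub x)
  simp [partialDeriv, h1.fderiv]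

/-- The mollifications of `w` have zero derivative on the smaller ball, hence are constant there,
and they converge to `w` almost everywhere. -/
theorem ae_eq_const_of_weakGradient_eq_zero {n : ℕ} {w : EuclideanSpace ℝ (Fin n) → ℝ}
    (hw : Integrable w) {x₀ : EuclideanSpace ℝ (Fin n)} {r : ℝ} (hr : 0 < r)
    (h : ∀ φ, IsTestFunction ⊤ (ball x₀ (2 * r)) φ → ∀ i, ∫ x, w x * partialDeriv i φ x = 0) :
    ∃ c, ∀ᵐ x, x ∈ ball x₀ r → w x = c := by
  -- The shift by 2 keeps every radius, including the one for `k = 0`, strictly below `r`, so that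
  -- bumps centred in the ball of radius `r` are supported in that of radius `2 * r`.
  let R : ℕ → ℝ := fun k ↦ r / (k + 2)
  have hR : ∀ k, 0 < R k := fun k ↦ by positivity
  have hRr : ∀ k, R k < r := fun k ↦ by
    have : (0 : ℝ) ≤ k := k.cast_nonneg
    rw [div_lt_iff₀ (by positivity)]
    nlinarith
  let η : ℕ → ContDiffBump (0 : EuclideanSpace ℝ (Fin n)) := fun k ↦
    ⟨R k / 2, R k, half_pos (hR k), half_lt_self (hR k)⟩
  have hRlim : Tendsto (fun k ↦ (η k).rOut) atTop (𝓝 0) := by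
    have : Tendsto (fun k : ℕ ↦ (k : ℝ) + 2) atTop atTop :=
      tendsto_atTop_add_const_right _ _ tendsto_natCast_atTop_atTop
    exact this.const_div_atTop r
  let g : ℕ → EuclideanSpace ℝ (Fin n) → ℝ := fun k ↦
    (η k).normed volume ⋆[ContinuousLinearMap.lsmul ℝ ℝ, volume] w
  have hsmooth : ∀ k, ContDiff ℝ ∞ ((η k).normed volume) := fun k ↦ (η k).contDiff_normed
  have hderiv : ∀ k, ∀ x ∈ ball x₀ r, HasFDerivAt (𝕜 := ℝ) (g k) 0 x := by
    intro k x hx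
    have h1 := (η k).hasCompactSupport_normed (μ := volume) |>.hasFDerivAt_convolution_right
      (ContinuousLinearMap.lsmul ℝ ℝ : ℝ →L[ℝ] ℝ →L[ℝ] ℝ).flip hw.locallyIntegrable ((hsmooth k).of_le (by simp)) x
    rw [convolution_flip] at h1
    refine h1.congr_fderiv (ContinuousLinearMap.eq_zero_of_apply_single fun i ↦ ?_)
    rw [convolution_precompR_apply _ hw.locallyIntegrable
      ((η k).hasCompactSupport_normed.fderiv (𝕜 := ℝ))
      ((hsmooth k).continuous_fderiv (by simp))]
    have h2 := h (fun t ↦ (η k).normed volume (x - t)) ⟨?_, ?_, ?_⟩ i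
    · simp_rw [partialDeriv_comp_sub_left i ((hsmooth k).differentiable (by simp)), mul_neg,
        integral_neg, neg_eq_zero] at h2
      rw [convolution_def, ← h2]
      simp [partialDeriv, mul_comm]
    · exact (hsmooth k).comp (contDiff_const.sub contDiff_id)
    · exact (η k).hasCompactSupport_normed.comp_homeomorph (Homeomorph.subLeft x)
    · refine (closure_mono (t := closedBall x (R k)) fun t ht ↦ ?_).trans ?_
      · have h3 : x - t ∈ Function.support ((η k).normed volume) := ht
        rw [(η k).support_normed_eq, mem_ball_zero_iff, ← dist_eq_norm, dist_comm] at h3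
        exact h3.le
      · rw [isClosed_closedBall.closure_eq]
        intro t ht
        have h4 := dist_triangle t x x₀
        rw [mem_closedBall] at ht
        rw [mem_ball] at hx ⊢
        linarith [hRr k]
  have hconst : ∀ k, ∀ x ∈ ball x₀ r, ∀ y ∈ ball x₀ r, g k x = g k y := fun k x hx y hy ↦
    isOpen_ball.is_const_of_fderiv_eq_zero (convex_ball x₀ r).isPreconnected
      (fun z hz ↦ (hderiv k z hz).differentiableAt.differentiableWithinAt)
      (fun z hz ↦ (hderiv k z hz).fderiv) hx hy
  have hlim : ∀ᵐ x, Tendsto (fun k ↦ g k x) atTop (𝓝 (w x)) :=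
    ContDiffBump.ae_convolution_tendsto_right_of_locallyIntegrable (K := 2) hRlim
      (Eventually.of_forall fun k ↦ by change R k ≤ 2 * (R k / 2); linarith) hw.locallyIntegrable
  obtain ⟨x₁, hx₁, hx₁lim⟩ : ∃ x₁ ∈ ball x₀ r, Tendsto (fun k ↦ g k x₁) atTop (𝓝 (w x₁)) := by
    have h1 : volume (ball x₀ r) ≠ 0 := (measure_ball_pos volume x₀ hr).ne'
    by_contra! hcon
    exact h1 (measure_mono_null hcon (ae_iff.mp hlim))
  refine ⟨w x₁, ?_⟩
  filter_upwards [hlim] with x hx hxr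
  refine tendsto_nhds_unique hx (hx₁lim.congr fun k ↦ hconst k x₁ hx₁ x hxr)

/-! ### Integrability along rays and the choice of the centre -/

theorem lintegral_comp_add_smul {n : ℕ} {F : EuclideanSpace ℝ (Fin n) → ENNReal}
    (hF : Measurable F) (a : EuclideanSpace ℝ (Fin n)) {t : ℝ} (ht : t ≠ 0) :
    ∫⁻ x, F (a + t • x) = ENNReal.ofReal |(t ^ n)⁻¹| * ∫⁻ x, F x := by
  have h1 := lintegral_map (μ := volume) (f := fun y ↦ F (a + y)) (by fun_prop)
    (measurable_const_smul t (α := EuclideanSpace ℝ (Fin n)))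
  have h2 := Measure.map_addHaar_smul (volume : Measure (EuclideanSpace ℝ (Fin n))) ht
  rw [finrank_euclideanSpace_fin] at h2
  rw [← h1]
  change ∫⁻ y, F (a + y) ∂(Measure.map (t • ·) volume) = _
  rw [h2, lintegral_smul_measure, lintegral_add_left_eq_self (fun y ↦ F y) a, smul_eq_mul]

theorem integral_comp_add_smul_sub {n : ℕ} (F : EuclideanSpace ℝ (Fin n) → ℝ)
    (y : EuclideanSpace ℝ (Fin n)) {t : ℝ} (ht : 0 < t) :
    ∫ x, F (y + t • (x - y)) = (t ^ n)⁻¹ * ∫ x, F x := by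
  have h1 := Measure.integral_comp_smul (volume : Measure (EuclideanSpace ℝ (Fin n)))
    (fun z ↦ F (y + z)) t
  rw [finrank_euclideanSpace_fin, integral_add_left_eq_self F y, smul_eq_mul,
    abs_of_pos (by positivity)] at h1
  rw [← h1, ← integral_sub_right_eq_self (fun x ↦ F (y + t • x)) y]

theorem lintegral_comp_add_smul_le {n : ℕ} {F : EuclideanSpace ℝ (Fin n) → ENNReal}
    (hF : Measurable F) (a : EuclideanSpace ℝ (Fin n)) {t : ℝ} (ht : 1 / 2 ≤ t) :
    ∫⁻ x, F (a + t • x) ≤ 2 ^ n * ∫⁻ x, F x := by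
  rw [lintegral_comp_add_smul hF a (by linarith)]
  gcongr
  have h1 : |(t ^ n)⁻¹| ≤ (2 : ℝ) ^ n := by
    rw [abs_of_nonneg (by positivity), ← inv_pow]
    gcongr
    rw [inv_le_comm₀ (by linarith) (by norm_num)]
    linarith
  refine (ENNReal.ofReal_le_ofReal h1).trans ?_
  rw [ENNReal.ofReal_pow (by norm_num)]
  simp

/-- For an integrable function on `ℝⁿ`, almost every point of `B` is a centre whose rays to the
points of `U` have a jointly integrable restriction of the function. -/
theorem exists_center_lintegral_lt_top {n : ℕ} {F : EuclideanSpace ℝ (Fin n) → ENNReal}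
    (hF : Measurable F) (hFint : ∫⁻ x, F x ≠ ⊤) {U B : Set (EuclideanSpace ℝ (Fin n))}
    (hUfin : volume U ≠ ⊤) (hBfin : volume B ≠ ⊤) (hBpos : volume B ≠ 0)
    (hB : MeasurableSet B) :
    ∃ y ∈ B, ∫⁻ t in Ioc (0 : ℝ) 1, ∫⁻ x in U, F (y + t • (x - y)) < ⊤ := by
  -- The point `y + t • (x - y)` is affine in `x` with factor `t` and in `y` with factor `1 - t`.
  -- One of the two is at least 1/2; substituting in that variable costs at most `2 ^ n`, uniformly
  -- in `t`.
  have hbound : ∀ t ∈ Ioc (0 : ℝ) 1, ∫⁻ y in B, ∫⁻ x in U, F (y + t • (x - y)) ≤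
      2 ^ n * (∫⁻ x, F x) * (volume B + volume U) := by
    intro t ht
    rcases le_total (1 / 2) t with h | h
    · have h1 : ∀ y, ∫⁻ x in U, F (y + t • (x - y)) ≤ 2 ^ n * ∫⁻ x, F x := fun y ↦ by
        refine (setLIntegral_le_lintegral _ _).trans ?_
        refine le_of_eq_of_le ?_ (lintegral_comp_add_smul_le hF (y - t • y) h)
        congr with x
        rw [smul_sub]
        congr 1
        abel
      refine (lintegral_mono h1).trans ?_
      rw [lintegral_const, Measure.restrict_apply_univ]
      gcongr
      exact le_self_add
    · have h1 : ∀ x, ∫⁻ y in B, F (y + t • (x - y)) ≤ 2 ^ n * ∫⁻ x, F x := fun x ↦ by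
        refine (setLIntegral_le_lintegral _ _).trans ?_
        refine le_of_eq_of_le ?_
          (lintegral_comp_add_smul_le hF (t • x) (t := 1 - t) (by linarith))
        congr with y
        rw [smul_sub, sub_smul, one_smul]
        congr 1
        abel
      rw [lintegral_lintegral_swap (by fun_prop)]
      refine (lintegral_mono h1).trans ?_
      rw [lintegral_const, Measure.restrict_apply_univ]
      gcongr
      exact le_add_self
  have hmeas : Measurable fun p : EuclideanSpace ℝ (Fin n) × ℝ ↦
      ∫⁻ x in U, F (p.1 + p.2 • (x - p.1)) := by
    refine Measurable.lintegral_prod_right' (f := fun q : (EuclideanSpace ℝ (Fin n) × ℝ) ×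
      EuclideanSpace ℝ (Fin n) ↦ F (q.1.1 + q.1.2 • (q.2 - q.1.1))) ?_
    fun_prop
  have hfin : ∫⁻ y in B, ∫⁻ t in Ioc (0 : ℝ) 1, ∫⁻ x in U, F (y + t • (x - y)) ≠ ⊤ := by
    rw [lintegral_lintegral_swap hmeas.aemeasurable]
    refine ((setLIntegral_mono' measurableSet_Ioc hbound).trans_lt ?_).ne
    rw [setLIntegral_const]
    simp only [Real.volume_Ioc, sub_zero, ENNReal.ofReal_one, mul_one]
    exact ENNReal.mul_lt_top (ENNReal.mul_lt_top (by simp) hFint.lt_top)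
      (ENNReal.add_lt_top.2 ⟨hBfin.lt_top, hUfin.lt_top⟩)
  have hae := ae_lt_top (hmeas.lintegral_prod_right') hfin
  by_contra! hcon
  have h2 : ∀ᵐ y ∂(volume.restrict B), False := by
    filter_upwards [hae, ae_restrict_mem hB] with y hy hyB
    exact absurd (hcon y hyB) (not_le.2 hy)
  rw [eventually_false_iff_eq_bot, ae_eq_bot, Measure.restrict_eq_zero] at h2
  exact hBpos h2

/-- Otherwise |a(s)| > |L| / (2s) near 0, and 1/s would be integrable there. -/
theorem eq_zero_of_tendsto_mul_of_integrableOn {a : ℝ → ℝ} {L : ℝ}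
    (ha : IntegrableOn a (Ioc 0 1)) (hL : Tendsto (fun s ↦ s * a s) (𝓝[>] 0) (𝓝 L)) :
    L = 0 := by
  by_contra hne
  have h1 : ∀ᶠ s in 𝓝[>] (0 : ℝ), |L| / 2 < |s * a s| :=
    hL.abs.eventually_const_lt (half_lt_self (abs_pos.2 hne))
  obtain ⟨δ, hδ, hδs⟩ := mem_nhdsGT_iff_exists_Ioc_subset.1 h1
  have hδ' : (0 : ℝ) < min δ 1 := lt_min hδ one_pos
  have h2 : IntegrableOn (fun s : ℝ ↦ s⁻¹) (Ioc 0 (min δ 1)) := by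
    refine Integrable.mono' ((ha.mono_set (Ioc_subset_Ioc_right (min_le_right δ 1))).norm.const_mul
      (2 / |L|)) (by fun_prop) ?_
    filter_upwards [ae_restrict_mem measurableSet_Ioc] with s hs
    have h3 : |L| / 2 < |s * a s| := hδs ⟨hs.1, hs.2.trans (min_le_left _ _)⟩
    have hLp := abs_pos.2 hne
    rw [abs_mul, abs_of_pos hs.1] at h3
    rw [Real.norm_eq_abs, Real.norm_eq_abs, abs_of_pos (inv_pos.2 hs.1), inv_eq_one_div,
      div_mul_eq_mul_div, div_le_div_iff₀ hs.1 hLp]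
    linarith
  have h4 := (intervalIntegrable_iff_integrableOn_Ioc_of_le hδ'.le).2 h2
  rw [intervalIntegrable_inv_iff] at h4
  rcases h4 with h4 | h4
  · exact hδ'.ne h4
  · exact h4 left_mem_uIcc

/-! ### Calculus of test functions -/

section TestFunctions

variable {n : ℕ} {U : Set (EuclideanSpace ℝ (Fin n))} {φ : EuclideanSpace ℝ (Fin n) → ℝ}

theorem fderiv_eq_sum_partialDeriv (x a : EuclideanSpace ℝ (Fin n)) :
    fderiv ℝ φ x a = ∑ j, a j * partialDeriv j φ x := by
  conv_lhs => rw [← (EuclideanSpace.basisFun (Fin n) ℝ).sum_repr a]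
  simp [partialDeriv]

theorem SobolevPoincare.IsTestFunction.mono {k : ℕ∞} {V : Set (EuclideanSpace ℝ (Fin n))}
    (h : IsTestFunction k U φ) (hUV : U ⊆ V) : IsTestFunction k V φ :=
  ⟨h.1, h.2, h.3.trans hUV⟩

theorem SobolevPoincare.IsTestFunction.of_top (k : ℕ∞) (h : IsTestFunction ⊤ U φ) : IsTestFunction k U φ :=
  ⟨h.1.of_le (by exact_mod_cast le_top), h.2, h.3⟩

theorem SobolevPoincare.IsTestFunction.differentiable (h : IsTestFunction ⊤ U φ) : Differentiable ℝ φ :=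
  h.1.differentiable (by simp)

theorem SobolevPoincare.IsTestFunction.continuous_fderiv (h : IsTestFunction ⊤ U φ) : Continuous (fderiv ℝ φ) :=
  h.1.continuous_fderiv (by simp)

theorem SobolevPoincare.IsTestFunction.continuous_partialDeriv (h : IsTestFunction ⊤ U φ) (i : Fin n) :
    Continuous (partialDeriv i φ) :=
  h.continuous_fderiv.clm_apply continuous_const

theorem SobolevPoincare.IsTestFunction.hasCompactSupport_partialDeriv (h : IsTestFunction ⊤ U φ) (i : Fin n) :
    HasCompactSupport (partialDeriv i φ) :=
  h.2.fderiv_apply (𝕜 := ℝ) _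

theorem SobolevPoincare.IsTestFunction.eq_zero_of_notMem (h : IsTestFunction ⊤ U φ)
    {x : EuclideanSpace ℝ (Fin n)} (hx : x ∉ U) : φ x = 0 :=
  image_eq_zero_of_notMem_tsupport fun hx' ↦ hx (h.3 hx')

theorem SobolevPoincare.IsTestFunction.partialDeriv_eq_zero_of_notMem (h : IsTestFunction ⊤ U φ) (i : Fin n)
    {x : EuclideanSpace ℝ (Fin n)} (hx : x ∉ U) : partialDeriv i φ x = 0 := by
  rw [partialDeriv, fderiv_of_notMem_tsupport ℝ fun hx' ↦ hx (h.3 hx')]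
  rfl

theorem SobolevPoincare.IsTestFunction.mul_left {ψ : EuclideanSpace ℝ (Fin n) → ℝ} (h : IsTestFunction ⊤ U φ)
    (hψ : ContDiff ℝ ∞ ψ) : IsTestFunction ⊤ U (fun x ↦ ψ x * φ x) :=
  ⟨hψ.mul h.1, h.2.mul_left, (tsupport_mul_subset_right).trans h.3⟩

theorem partialDeriv_mul {ψ : EuclideanSpace ℝ (Fin n) → ℝ} (i : Fin n)
    {x : EuclideanSpace ℝ (Fin n)} (hψ : DifferentiableAt ℝ ψ x) (hφ : DifferentiableAt ℝ φ x) :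
    partialDeriv i (fun x ↦ ψ x * φ x) x =
      partialDeriv i ψ x * φ x + ψ x * partialDeriv i φ x := by
  simp only [partialDeriv, fderiv_fun_mul hψ hφ]
  simp
  ring

theorem contDiff_apply_sub (y : EuclideanSpace ℝ (Fin n)) (j : Fin n) :
    ContDiff ℝ ∞ (fun z : EuclideanSpace ℝ (Fin n) ↦ z j - y j) := by
  fun_prop

theorem partialDeriv_apply_sub (y x : EuclideanSpace ℝ (Fin n)) (i j : Fin n) :
    partialDeriv i (fun z : EuclideanSpace ℝ (Fin n) ↦ z j - y j) x = if i = j then 1 else 0 := by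
  have h1 : HasFDerivAt (fun z : EuclideanSpace ℝ (Fin n) ↦ z j - y j)
      (EuclideanSpace.proj j : EuclideanSpace ℝ (Fin n) →L[ℝ] ℝ) x :=
    (EuclideanSpace.proj j : EuclideanSpace ℝ (Fin n) →L[ℝ] ℝ).hasFDerivAt.sub_const _
  rw [partialDeriv, h1.fderiv]
  simp [eq_comm]

theorem hasFDerivAt_add_smul_sub (y z : EuclideanSpace ℝ (Fin n)) (c : ℝ) :
    HasFDerivAt (fun z ↦ y + c • (z - y)) (c • ContinuousLinearMap.id ℝ _) z :=
  (((hasFDerivAt_id z).sub_const y).const_smul c).const_add y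

theorem partialDeriv_comp_add_smul_sub (i : Fin n) (hφ : Differentiable ℝ φ)
    (y z : EuclideanSpace ℝ (Fin n)) (c : ℝ) :
    partialDeriv i (fun z ↦ φ (y + c • (z - y))) z = c * partialDeriv i φ (y + c • (z - y)) := by
  have h1 := (hφ (y + c • (z - y))).hasFDerivAt.comp z (hasFDerivAt_add_smul_sub y z c)
  have h2 : fderiv ℝ (fun z ↦ φ (y + c • (z - y))) z = _ := h1.fderiv
  simp [partialDeriv, h2]

/-- The support is contracted towards `y` by the factor `t`, so it stays in a set star-shaped about
`y`. -/
theorem SobolevPoincare.IsTestFunction.comp_add_smul_sub (h : IsTestFunction ⊤ U φ)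
    {y : EuclideanSpace ℝ (Fin n)} (hU : StarConvex ℝ y U) {t : ℝ} (ht : t ∈ Ioc (0 : ℝ) 1) :
    IsTestFunction ⊤ U (fun z ↦ φ (y + t⁻¹ • (z - y))) := by
  let e : EuclideanSpace ℝ (Fin n) ≃ₜ EuclideanSpace ℝ (Fin n) :=
    ((Homeomorph.subRight y).trans (Homeomorph.smulOfNeZero t⁻¹ (inv_ne_zero ht.1.ne'))).trans
      (Homeomorph.addLeft y)
  refine ⟨h.1.comp (by fun_prop), h.2.comp_homeomorph e, fun z hz ↦ ?_⟩
  have h1 : tsupport (φ ∘ e) = e ⁻¹' tsupport φ := tsupport_comp_eq_preimage φ e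
  have h2 : e z ∈ U := h.3 (h1.subset hz : z ∈ e ⁻¹' tsupport φ)
  have h3 := hU h2 (sub_nonneg.2 ht.2) ht.1.le (sub_add_cancel 1 t)
  convert h3 using 1
  change z = (1 - t) • y + t • (y + t⁻¹ • (z - y))
  rw [smul_add, smul_inv_smul₀ ht.1.ne', sub_smul, one_smul]
  abel

end TestFunctions

/-! ### Poincaré's formula on star-shaped sets -/

theorem MeasureTheory.Integrable.mul_continuous_of_hasCompactSupport {n : ℕ}
    {f ψ : EuclideanSpace ℝ (Fin n) → ℝ} (hf : Integrable f) (hψ : Continuous ψ)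
    (hψs : HasCompactSupport ψ) : Integrable (fun x ↦ f x * ψ x) := by
  obtain ⟨C, hC⟩ := hψs.exists_bound_of_continuous hψ
  exact hf.mul_bdd hψ.aestronglyMeasurable (Eventually.of_forall hC)

/-- The curl-free condition tested with `z ↦ (z j - y j) * φ z`, summed over `j`. -/
theorem integral_radial_mul_partialDeriv {n : ℕ} {U : Set (EuclideanSpace ℝ (Fin n))}
    {e : EuclideanSpace ℝ (Fin n) → Fin n → ℝ} (he : ∀ i, Integrable fun x ↦ e x i)
    (hcurl : ∀ φ, IsTestFunction 1 U φ → ∀ i j,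
      ∫ x, (e x i * partialDeriv j φ x - e x j * partialDeriv i φ x) = 0)
    {φ : EuclideanSpace ℝ (Fin n) → ℝ} (hφ : IsTestFunction ⊤ U φ)
    (y : EuclideanSpace ℝ (Fin n)) (i : Fin n) :
    ∫ z, (∑ j, e z j * (z j - y j)) * partialDeriv i φ z =
      ∫ z, e z i * ((n - 1) * φ z + fderiv ℝ φ z (z - y)) := by
  have hD := hφ.differentiable
  -- The product rule produces an extra `φ` on the right for every `j`, and one on the left for `j =
  -- i`, here moved to the right. Summation over `j` therefore leaves the coefficient `n - 1`.
  have key : ∀ j, ∫ z, (e z j * ((z j - y j) * partialDeriv i φ z) -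
      e z i * (φ z + (z j - y j) * partialDeriv j φ z - if i = j then φ z else 0)) = 0 := by
    intro j
    have h1 := hcurl _ ((hφ.mul_left (contDiff_apply_sub y j)).of_top 1) j i
    refine (integral_congr_ae (Eventually.of_forall fun z ↦ ?_)).trans h1
    dsimp only
    rw [partialDeriv_mul i ((contDiff_apply_sub y j).differentiable (by simp) z) (hD z),
      partialDeriv_mul j ((contDiff_apply_sub y j).differentiable (by simp) z) (hD z),
      partialDeriv_apply_sub, partialDeriv_apply_sub]
    by_cases hij : i = j
    · subst hij; simp
    · simp [hij]
  have hc : ∀ j, Continuous fun z : EuclideanSpace ℝ (Fin n) ↦ z j - y j := fun j ↦ by fun_prop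
  have hint1 : ∀ j, Integrable fun z ↦ e z j * ((z j - y j) * partialDeriv i φ z) := fun j ↦
    (he j).mul_continuous_of_hasCompactSupport ((hc j).mul (hφ.continuous_partialDeriv i))
      (hφ.hasCompactSupport_partialDeriv i).mul_left
  have hint2 : ∀ j, Integrable fun z ↦ e z i *
      (φ z + (z j - y j) * partialDeriv j φ z - if i = j then φ z else 0) := fun j ↦ by
    have h1 : Continuous fun z ↦ (if i = j then φ z else 0) := by
      split_ifs
      exacts [hφ.1.continuous, continuous_const]
    have h2 : HasCompactSupport fun z ↦ (if i = j then φ z else 0) := by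
      split_ifs
      exacts [hφ.2, HasCompactSupport.zero]
    exact (he i).mul_continuous_of_hasCompactSupport
      ((hφ.1.continuous.add ((hc j).mul (hφ.continuous_partialDeriv j))).sub h1)
      ((hφ.2.add (hφ.hasCompactSupport_partialDeriv j).mul_left).sub h2)
  have h3 : ∫ z, ∑ j, (e z j * ((z j - y j) * partialDeriv i φ z) -
      e z i * (φ z + (z j - y j) * partialDeriv j φ z - if i = j then φ z else 0)) = 0 := by
    have h4 := integral_finsetSum Finset.univ fun j (_ : j ∈ Finset.univ) ↦
      (hint1 j).sub (hint2 j)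
    simp only [Pi.sub_apply] at h4
    rw [h4]
    exact Finset.sum_eq_zero fun j _ ↦ key j
  simp_rw [Finset.sum_sub_distrib] at h3
  rw [integral_sub (integrable_finsetSum _ fun j _ ↦ hint1 j)
    (integrable_finsetSum _ fun j _ ↦ hint2 j), sub_eq_zero] at h3
  refine (integral_congr_ae (Eventually.of_forall fun z ↦ ?_)).trans
    (h3.trans (integral_congr_ae (Eventually.of_forall fun z ↦ ?_)))
  · dsimp only
    rw [Finset.sum_mul]
    exact Finset.sum_congr rfl fun j _ ↦ mul_assoc _ _ _
  · dsimp only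
    rw [← Finset.mul_sum, Finset.sum_sub_distrib, Finset.sum_add_distrib,
      fderiv_eq_sum_partialDeriv]
    simp
    ring_nf
    simp

/-- `e` is the weak gradient of `v` on the open set `U`. The integrals range over the whole space
since the test functions vanish outside of `U`. -/
def IsWeakPotential {n : ℕ} (U : Set (EuclideanSpace ℝ (Fin n)))
    (v : EuclideanSpace ℝ (Fin n) → ℝ) (e : EuclideanSpace ℝ (Fin n) → Fin n → ℝ) : Prop :=
  ∀ φ, IsTestFunction ⊤ U φ → ∀ i, ∫ x, v x * partialDeriv i φ x = -∫ x, e x i * φ x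

section Star

variable {n : ℕ} {U : Set (EuclideanSpace ℝ (Fin n))}
  {e : EuclideanSpace ℝ (Fin n) → Fin n → ℝ} {φ : EuclideanSpace ℝ (Fin n) → ℝ}
  {y : EuclideanSpace ℝ (Fin n)}

/-- The substitution z = y + t(x - y) moves the dilation from `e`, which has no regularity, to `φ`.
The factor t from the radial vector cancels the t⁻¹ from differentiating the dilated `φ`, and the
curl identity applies to the latter. -/
theorem integral_radial_slice (he : ∀ i, Integrable fun x ↦ e x i)
    (hcurl : ∀ φ, IsTestFunction 1 U φ → ∀ i j,
      ∫ x, (e x i * partialDeriv j φ x - e x j * partialDeriv i φ x) = 0)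
    (hφ : IsTestFunction ⊤ U φ) (hU : StarConvex ℝ y U) (i : Fin n) {t : ℝ}
    (ht : t ∈ Ioc (0 : ℝ) 1) :
    ∫ x, (∑ j, e (y + t • (x - y)) j * (x j - y j)) * partialDeriv i φ x =
      ∫ z, e z i * ((t ^ n)⁻¹ * ((n - 1) * φ (y + t⁻¹ • (z - y)) +
        fderiv ℝ φ (y + t⁻¹ • (z - y)) (y + t⁻¹ • (z - y) - y))) := by
  have htest := hφ.comp_add_smul_sub hU ht
  have h1 := integral_radial_mul_partialDeriv he hcurl htest y i
  have h2 := integral_comp_add_smul_sub (fun z ↦ (∑ j, e z j * (z j - y j)) *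
    partialDeriv i (fun z ↦ φ (y + t⁻¹ • (z - y))) z) y ht.1
  rw [h1, ← integral_const_mul] at h2
  refine Eq.trans ?_ (h2.trans ?_)
  · refine integral_congr_ae (Eventually.of_forall fun x ↦ ?_)
    have h3 : ∑ j, e (y + t • (x - y)) j * ((y + t • (x - y)) j - y j) =
        t * ∑ j, e (y + t • (x - y)) j * (x j - y j) := by
      rw [Finset.mul_sum]
      refine Finset.sum_congr rfl fun j _ ↦ ?_
      simp
      ring
    dsimp only
    rw [h3, partialDeriv_comp_add_smul_sub i hφ.differentiable, add_sub_cancel_left,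
      inv_smul_smul₀ ht.1.ne', add_sub_cancel]
    field_simp [ht.1.ne']
  · refine integral_congr_ae (Eventually.of_forall fun z ↦ ?_)
    dsimp only
    rw [fderiv_eq_sum_partialDeriv, fderiv_eq_sum_partialDeriv]
    simp_rw [partialDeriv_comp_add_smul_sub _ hφ.differentiable]
    have h3 : ∀ j, (z - y) j * (t⁻¹ * partialDeriv j φ (y + t⁻¹ • (z - y))) =
        (y + t⁻¹ • (z - y) - y) j * partialDeriv j φ (y + t⁻¹ • (z - y)) := fun j ↦ by
      simp; ring
    simp_rw [h3]
    ring

/-- This recognizes the weight of `e z i` in `integral_radial_slice` as minus a total derivative in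
`t`. The exponent `1 - n` is an integer, possibly negative. -/
theorem hasDerivAt_dilation (hφ : Differentiable ℝ φ) (y z : EuclideanSpace ℝ (Fin n)) {t : ℝ}
    (ht : 0 < t) :
    HasDerivAt (fun t : ℝ ↦ t ^ (1 - n : ℤ) * φ (y + t⁻¹ • (z - y)))
      (-((t ^ n)⁻¹ * ((n - 1) * φ (y + t⁻¹ • (z - y)) +
        fderiv ℝ φ (y + t⁻¹ • (z - y)) (y + t⁻¹ • (z - y) - y)))) t := by
  have h1 : HasDerivAt (fun t : ℝ ↦ y + t⁻¹ • (z - y)) (-(t ^ 2)⁻¹ • (z - y)) t :=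
    ((hasDerivAt_inv ht.ne').smul_const (z - y)).const_add y
  have h2 := (hφ (y + t⁻¹ • (z - y))).hasFDerivAt.comp_hasDerivAt t h1
  have h3 := (hasDerivAt_zpow (1 - n : ℤ) t (Or.inl ht.ne')).mul h2
  refine h3.congr_deriv ?_
  have h4 : t ^ (1 - n - 1 : ℤ) = (t ^ n)⁻¹ := by
    rw [show (1 - n - 1 : ℤ) = -n by ring, zpow_neg, zpow_natCast]
  have h5 : t ^ (1 - n : ℤ) = t * (t ^ n)⁻¹ := by
    rw [sub_eq_add_neg, zpow_add₀ ht.ne', zpow_one, zpow_neg, zpow_natCast]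
  rw [h4, h5, add_sub_cancel_left, map_smul, map_smul]
  simp only [Function.comp, smul_eq_mul]
  push_cast
  field_simp
  ring

theorem intervalIntegral_dilation (hφ : IsTestFunction ⊤ U φ) (y z : EuclideanSpace ℝ (Fin n))
    {s : ℝ} (hs : s ∈ Ioc (0 : ℝ) 1) :
    ∫ t in s..1, (t ^ n)⁻¹ * ((n - 1) * φ (y + t⁻¹ • (z - y)) +
        fderiv ℝ φ (y + t⁻¹ • (z - y)) (y + t⁻¹ • (z - y) - y)) =
      s * ((s ^ n)⁻¹ * φ (y + s⁻¹ • (z - y))) - φ z := by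
  have hpos : ∀ t ∈ uIcc s 1, 0 < t := fun t ht ↦ by
    rw [uIcc_of_le hs.2] at ht
    exact hs.1.trans_le ht.1
  have hφc := hφ.1.continuous
  have hφd := hφ.continuous_fderiv
  have hcont : ContinuousOn (fun t : ℝ ↦ -((t ^ n)⁻¹ * ((n - 1) * φ (y + t⁻¹ • (z - y)) +
        fderiv ℝ φ (y + t⁻¹ • (z - y)) (y + t⁻¹ • (z - y) - y)))) (uIcc s 1) := by
    have h1 : ContinuousOn (fun t : ℝ ↦ t⁻¹) (uIcc s 1) :=
      continuousOn_inv₀.mono fun t ht ↦ (hpos t ht).ne'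
    have h2 : ContinuousOn (fun t : ℝ ↦ (t ^ n)⁻¹) (uIcc s 1) :=
      (continuousOn_pow n).inv₀ fun t ht ↦ (pow_pos (hpos t ht) n).ne'
    have h3 : ContinuousOn (fun t : ℝ ↦ y + t⁻¹ • (z - y)) (uIcc s 1) := by fun_prop
    exact (h2.mul ((continuousOn_const.mul (hφc.comp_continuousOn h3)).add
      ((hφd.comp_continuousOn h3).clm_apply (h3.sub continuousOn_const)))).neg
  have h1 := intervalIntegral.integral_eq_sub_of_hasDerivAt
    (fun t ht ↦ hasDerivAt_dilation hφ.differentiable y z (hpos t ht)) hcont.intervalIntegrable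
  rw [intervalIntegral.integral_neg, neg_eq_iff_eq_neg] at h1
  rw [h1, sub_eq_add_neg (1 : ℤ), zpow_add₀ hs.1.ne', zpow_one, zpow_neg, zpow_natCast]
  simp
  ring

/-- For `t ≥ s > 0` the weight of `e z i` is bounded, so Fubini applies and the `t`-integral is
explicit. Its end `t = 1` gives `∫ e i * φ`, its end `t = s` the remainder, after undoing the
substitution. -/
theorem intervalIntegral_radial (he : ∀ i, Integrable fun x ↦ e x i)
    (hcurl : ∀ φ, IsTestFunction 1 U φ → ∀ i j,
      ∫ x, (e x i * partialDeriv j φ x - e x j * partialDeriv i φ x) = 0)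
    (hφ : IsTestFunction ⊤ U φ) (hU : StarConvex ℝ y U) (i : Fin n) {s : ℝ}
    (hs : s ∈ Ioc (0 : ℝ) 1) :
    ∫ t in s..1, ∫ x, (∑ j, e (y + t • (x - y)) j * (x j - y j)) * partialDeriv i φ x =
      s * (∫ x, e (y + s • (x - y)) i * φ x) - ∫ x, e x i * φ x := by
  let Θ : EuclideanSpace ℝ (Fin n) → ℝ := fun p ↦ (n - 1) * φ p + fderiv ℝ φ p (p - y)
  have hΘc : Continuous Θ := (continuous_const.mul hφ.1.continuous).add
    (hφ.continuous_fderiv.clm_apply (continuous_id.sub continuous_const))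
  have hΘs : HasCompactSupport Θ := by
    refine HasCompactSupport.add hφ.2.mul_left ?_
    refine (hφ.2.fderiv (𝕜 := ℝ)).mono fun p hp ↦ ?_
    rw [Function.mem_support] at hp ⊢
    rintro h
    simp [h] at hp
  obtain ⟨C, hC⟩ := hΘs.exists_bound_of_continuous hΘc
  have h1 : ∫ t in s..1, ∫ x, (∑ j, e (y + t • (x - y)) j * (x j - y j)) * partialDeriv i φ x =
      ∫ t in Ioc s 1, ∫ z, e z i * ((t ^ n)⁻¹ * Θ (y + t⁻¹ • (z - y))) := by
    rw [intervalIntegral.integral_of_le hs.2]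
    exact setIntegral_congr_fun measurableSet_Ioc fun t ht ↦
      integral_radial_slice he hcurl hφ hU i ⟨hs.1.trans ht.1, ht.2⟩
  have hint : Integrable (Function.uncurry fun (t : ℝ) z ↦
      e z i * ((t ^ n)⁻¹ * Θ (y + t⁻¹ • (z - y)))) ((volume.restrict (Ioc s 1)).prod volume) := by
    -- On `t > s` the factor `(t ^ n)⁻¹` is at most `(s ^ n)⁻¹`, and `C` bounds `Θ`.
    refine ((he i).comp_snd (volume.restrict (Ioc s 1))).mul_bdd (c := (s ^ n)⁻¹ * C) ?_ ?_
    · have hΘm := hΘc.measurable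
      exact Measurable.aestronglyMeasurable (by fun_prop)
    · filter_upwards [Measure.quasiMeasurePreserving_fst.ae (ae_restrict_mem measurableSet_Ioc)]
        with p hp
      rw [norm_mul, Real.norm_of_nonneg (inv_nonneg.2 (pow_nonneg (hs.1.trans hp.1).le n))]
      have h2 : s ^ n ≤ p.1 ^ n := pow_le_pow_left₀ hs.1.le hp.1.le n
      have h3 : 0 < s ^ n := pow_pos hs.1 n
      gcongr
      exact hC _
  rw [h1, integral_integral_swap hint]
  have h2 : ∀ z, ∫ t in Ioc s 1, e z i * ((t ^ n)⁻¹ * Θ (y + t⁻¹ • (z - y))) =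
      s * ((s ^ n)⁻¹ * (e z i * φ (y + s⁻¹ • (z - y)))) - e z i * φ z := fun z ↦ by
    rw [integral_const_mul, ← intervalIntegral.integral_of_le hs.2,
      intervalIntegral_dilation hφ y z hs]
    ring
  have htest := hφ.comp_add_smul_sub hU hs
  simp_rw [h2]
  rw [integral_sub ((((he i).mul_continuous_of_hasCompactSupport htest.1.continuous
    htest.2).const_mul _).const_mul _)
    ((he i).mul_continuous_of_hasCompactSupport hφ.1.continuous hφ.2), integral_const_mul,
    integral_const_mul]
  congr 2
  rw [← integral_comp_add_smul_sub (fun z ↦ e z i * φ (y + s⁻¹ • (z - y))) y hs.1]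
  refine integral_congr_ae (Eventually.of_forall fun x ↦ ?_)
  dsimp only
  rw [add_sub_cancel_left, inv_smul_smul₀ hs.1.ne', add_sub_cancel]

end Star

theorem setIntegral_mul_eq_integral_mul {n : ℕ} {U : Set (EuclideanSpace ℝ (Fin n))}
    {f ψ : EuclideanSpace ℝ (Fin n) → ℝ} (hψ : ∀ x, x ∉ U → ψ x = 0) :
    ∫ x in U, f x * ψ x = ∫ x, f x * ψ x :=
  setIntegral_eq_integral_of_forall_compl_eq_zero fun x hx ↦ by rw [hψ x hx, mul_zero]

theorem exists_weakPotential_of_starConvex {n : ℕ} {U B : Set (EuclideanSpace ℝ (Fin n))}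
    {e : EuclideanSpace ℝ (Fin n) → Fin n → ℝ} (hUo : IsOpen U)
    (hUb : Bornology.IsBounded U) (hBo : IsOpen B) (hBb : Bornology.IsBounded B)
    (hBne : B.Nonempty) (hstar : ∀ y ∈ B, StarConvex ℝ y U)
    (hem : ∀ i, Measurable fun x ↦ e x i) (he : ∀ i, Integrable fun x ↦ e x i)
    (hcurl : ∀ φ, IsTestFunction 1 U φ → ∀ i j,
      ∫ x, (e x i * partialDeriv j φ x - e x j * partialDeriv i φ x) = 0) :
    ∃ v, IntegrableOn v U ∧ IsWeakPotential U v e := by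
  obtain ⟨y, hyB, hy⟩ := exists_center_lintegral_lt_top (F := fun x ↦ ∑ j, ‖e x j‖ₑ)
    (by fun_prop) (by
      rw [lintegral_finsetSum _ (by fun_prop)]
      exact (ENNReal.sum_lt_top.2 fun j _ ↦ (he j).2).ne)
    hUb.measure_lt_top.ne hBb.measure_lt_top.ne (hBo.measure_pos volume hBne).ne'
    hBo.measurableSet
  have hU := hstar y hyB
  have hray : ∀ j, Measurable fun p : ℝ × EuclideanSpace ℝ (Fin n) ↦
      e (y + p.1 • (p.2 - y)) j := fun j ↦
    (hem j).comp (g := fun x ↦ e x j) (f := fun p : ℝ × EuclideanSpace ℝ (Fin n) ↦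
      y + p.1 • (p.2 - y)) (by fun_prop)
  have hf : ∀ j, Integrable (fun p : ℝ × EuclideanSpace ℝ (Fin n) ↦
      e (y + p.1 • (p.2 - y)) j)
      ((volume.restrict (Ioc 0 1)).prod (volume.restrict U)) := fun j ↦ by
    refine ⟨(hray j).aestronglyMeasurable, ?_⟩
    rw [HasFiniteIntegral, lintegral_prod _ (hray j).enorm.aemeasurable]
    refine lt_of_le_of_lt ?_ hy
    gcongr with t x
    exact Finset.single_le_sum (f := fun j ↦ ‖e (y + t • (x - y)) j‖ₑ) (fun _ _ ↦ zero_le)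
      (Finset.mem_univ j)
  obtain ⟨C, hC⟩ := hUb.exists_norm_le
  have hmemU : ∀ᵐ p : ℝ × EuclideanSpace ℝ (Fin n)
      ∂(volume.restrict (Ioc 0 1)).prod (volume.restrict U), p.2 ∈ U :=
    Measure.quasiMeasurePreserving_snd.ae (ae_restrict_mem hUo.measurableSet)
  have hS : Integrable (fun p : ℝ × EuclideanSpace ℝ (Fin n) ↦
      ∑ j, e (y + p.1 • (p.2 - y)) j * (p.2 j - y j))
      ((volume.restrict (Ioc 0 1)).prod (volume.restrict U)) := by
    refine integrable_finsetSum _ fun j _ ↦ (hf j).mul_bdd (c := C + ‖y‖) ?_ ?_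
    · have hcont : Continuous fun p : ℝ × EuclideanSpace ℝ (Fin n) ↦ p.2 j - y j := by fun_prop
      exact hcont.aestronglyMeasurable
    · filter_upwards [hmemU] with p hp
      exact (PiLp.norm_apply_le (p.2 - y) j).trans ((norm_sub_le _ _).trans
        (add_le_add_left (hC _ hp) _))
  have hbdd : ∀ {g : ℝ × EuclideanSpace ℝ (Fin n) → ℝ} {ψ : EuclideanSpace ℝ (Fin n) → ℝ},
      Integrable g ((volume.restrict (Ioc 0 1)).prod (volume.restrict U)) → Continuous ψ →
      HasCompactSupport ψ → Integrable (fun p ↦ g p * ψ p.2)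
        ((volume.restrict (Ioc 0 1)).prod (volume.restrict U)) := by
    intro g ψ hg hψ hψs
    obtain ⟨c, hc⟩ := hψs.exists_bound_of_continuous hψ
    exact hg.mul_bdd (hψ.comp continuous_snd).aestronglyMeasurable
      (Eventually.of_forall fun p ↦ hc p.2)
  refine ⟨fun x ↦ ∫ t in Ioc (0 : ℝ) 1, ∑ j, e (y + t • (x - y)) j * (x j - y j),
    hS.integral_prod_right, fun φ hφ i ↦ ?_⟩
  -- `J` is the slice at `t` of the potential tested with `∂ᵢφ`; `a` occurs in the remainder `s * a
  -- s`. Both are integrable on (0, 1] by the choice of `y`.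
  let J : ℝ → ℝ := fun t ↦
    ∫ x, (∑ j, e (y + t • (x - y)) j * (x j - y j)) * partialDeriv i φ x
  let a : ℝ → ℝ := fun s ↦ ∫ x, e (y + s • (x - y)) i * φ x
  have hJU : ∀ t, ∫ x in U, (∑ j, e (y + t • (x - y)) j * (x j - y j)) * partialDeriv i φ x =
      J t := fun t ↦
    setIntegral_mul_eq_integral_mul fun x hx ↦ hφ.partialDeriv_eq_zero_of_notMem i hx
  have haU : ∀ s, ∫ x in U, e (y + s • (x - y)) i * φ x = a s := fun s ↦
    setIntegral_mul_eq_integral_mul fun x hx ↦ hφ.eq_zero_of_notMem hx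
  have hSφ := hbdd hS (hφ.continuous_partialDeriv i) (hφ.hasCompactSupport_partialDeriv i)
  have hJ : IntegrableOn J (Ioc 0 1) := by
    have h1 := hSφ.integral_prod_left
    simp only [hJU] at h1
    exact h1
  have ha : IntegrableOn a (Ioc 0 1) := by
    have h1 := (hbdd (hf i) hφ.1.continuous hφ.2).integral_prod_left
    simp only [haU] at h1
    exact h1
  have h1 : ∫ x, (∫ t in Ioc (0 : ℝ) 1, ∑ j, e (y + t • (x - y)) j * (x j - y j)) *
      partialDeriv i φ x = ∫ t in (0 : ℝ)..1, J t := by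
    rw [← setIntegral_mul_eq_integral_mul (U := U)
      fun x hx ↦ hφ.partialDeriv_eq_zero_of_notMem i hx,
      intervalIntegral.integral_of_le zero_le_one]
    simp_rw [← hJU, ← integral_mul_const]
    exact (integral_integral_swap (f := fun t x ↦
      (∑ j, e (y + t • (x - y)) j * (x j - y j)) * partialDeriv i φ x) hSφ).symm
  have hcont : Tendsto (fun s ↦ ∫ t in s..1, J t) (𝓝[>] 0) (𝓝 (∫ t in (0 : ℝ)..1, J t)) := by
    have h2 : IntegrableOn J (uIcc 0 1) := by
      rwa [uIcc_of_le zero_le_one, integrableOn_Icc_iff_integrableOn_Ioc]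
    have h3 := intervalIntegral.continuousOn_primitive_interval_left h2 0 left_mem_uIcc
    refine h3.tendsto.mono_left (nhdsWithin_le_of_mem ?_)
    rw [uIcc_of_le zero_le_one]
    exact mem_of_superset (Ioc_mem_nhdsGT zero_lt_one) Ioc_subset_Icc_self
  -- The limit is the defect in the weak gradient identity; integrability of `a` forces it to be
  -- zero.
  have hlim : Tendsto (fun s ↦ s * a s) (𝓝[>] 0)
      (𝓝 ((∫ t in (0 : ℝ)..1, J t) + ∫ x, e x i * φ x)) := by
    refine (hcont.add_const _).congr' ?_
    filter_upwards [Ioc_mem_nhdsGT (zero_lt_one' ℝ)] with s hs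
    rw [intervalIntegral_radial he hcurl hφ hU i hs, sub_add_cancel]
  rw [h1]
  exact eq_neg_of_add_eq_zero_left (eq_zero_of_tendsto_mul_of_integrableOn ha hlim)

/-! ### Star-shaped pieces of Lipschitz domains -/

theorem IsOpen.convexJoin {V : Type*} [NormedAddCommGroup V] [NormedSpace ℝ V] {A B : Set V}
    (hA : IsOpen A) (hB : IsOpen B) : IsOpen (convexJoin ℝ A B) := by
  refine Metric.isOpen_iff.2 fun z hz ↦ ?_
  obtain ⟨x, hx, y, hy, a, b, ha, hb, hab, rfl⟩ := mem_convexJoin.1 hz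
  obtain ⟨ε, hε, hεA⟩ := Metric.isOpen_iff.1 hA x hx
  obtain ⟨δ, hδ, hδB⟩ := Metric.isOpen_iff.1 hB y hy
  refine ⟨min ε δ, lt_min hε hδ, fun w hw ↦ ?_⟩
  set d := w - (a • x + b • y) with hd
  have hdn : ‖d‖ < min ε δ := by rwa [mem_ball_iff_norm] at hw
  refine mem_convexJoin.2 ⟨x + d, hεA ?_, y + d, hδB ?_, a, b, ha, hb, hab, ?_⟩
  · simpa using hdn.trans_le (min_le_left _ _)
  · simpa using hdn.trans_le (min_le_right _ _)
  · have h1 : a • (x + d) + b • (y + d) = (a • x + b • y) + (a + b) • d := by module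
    rw [h1, hab, one_smul, hd]
    abel

/-- By associativity of joins, a segment from a point of `[x, y']` to `y` lies in the join of `x`
with `[y', y]`, and the latter segment lies in `B`. -/
theorem starConvex_convexJoin {V : Type*} [AddCommGroup V] [Module ℝ V] {A B : Set V}
    (hB : Convex ℝ B) {y : V} (hy : y ∈ B) : StarConvex ℝ y (convexJoin ℝ A B) := by
  refine starConvex_iff_segment_subset.2 fun z hz ↦ ?_
  obtain ⟨x, hx, y', hy', hz'⟩ := mem_convexJoin.1 hz
  intro p hp
  have h1 : p ∈ convexJoin ℝ (convexJoin ℝ {x} {y'}) {y} :=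
    mem_convexJoin.2 ⟨z, by simpa using hz', y, rfl, by rwa [segment_symm]⟩
  rw [convexJoin_assoc] at h1
  refine convexJoin_mono (singleton_subset_iff.2 hx) ?_ h1
  simpa using hB.segment_subset hy' hy

/-- Every point of the closure of a Lipschitz domain `Ω` has a neighbourhood whose intersection
with `Ω` lies in an open subset of `Ω` that is star-shaped with respect to a ball. -/
theorem SobolevPoincare.IsBoundedLipschitzDomain.exists_starConvex {n : ℕ}
    {Ω : Set (EuclideanSpace ℝ (Fin n))} (hΩ : IsBoundedLipschitzDomain Ω)
    {x₀ : EuclideanSpace ℝ (Fin n)} (hx₀ : x₀ ∈ closure Ω) :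
    ∃ R > 0, ∃ U ⊆ Ω, IsOpen U ∧ ball x₀ R ∩ Ω ⊆ U ∧ ∃ B : Set (EuclideanSpace ℝ (Fin n)),
      IsOpen B ∧ Bornology.IsBounded B ∧ B.Nonempty ∧ ∀ y ∈ B, StarConvex ℝ y U := by
  by_cases hx : x₀ ∈ Ω
  · obtain ⟨R, hR, hRΩ⟩ := Metric.isOpen_iff.1 hΩ.isOpen x₀ hx
    exact ⟨R, hR, ball x₀ R, hRΩ, isOpen_ball, inter_subset_left, ball x₀ R, isOpen_ball,
      isBounded_ball, nonempty_ball.2 hR, fun y hy ↦ (convex_ball x₀ R).starConvex hy⟩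
  obtain ⟨r, hr, e, he, K, g, hg, hgΩ⟩ := hΩ.boundary x₀
    (by rw [hΩ.isOpen.frontier_eq]; exact ⟨hx₀, hx⟩)
  have hK : (0 : ℝ) ≤ K := K.coe_nonneg
  set R : ℝ := r / (4 + 4 * K) with hRdef
  have hR : 0 < R := by positivity
  have hRr : (4 + 4 * K) * R = r := by rw [hRdef]; field_simp
  -- The height `h` is such that moving from the small ball to the raised one climbs at least `h - 2
  -- * R = 4 * K * R`, while the graph rises by at most `K` times a horizontal displacement of at
  -- most `4 * R`. Moreover `h + R < r`, so the raised ball stays in the chart.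
  set h : ℝ := (2 + 4 * K) * R with hhdef
  have hKR : 0 ≤ K * R := by positivity
  refine ⟨R, hR, convexJoin ℝ (ball x₀ R ∩ Ω) (ball (x₀ + h • e) R), ?_,
    (isOpen_ball.inter hΩ.isOpen).convexJoin isOpen_ball,
    subset_convexJoin_left (nonempty_ball.2 hR), ball (x₀ + h • e) R, isOpen_ball, isBounded_ball,
    nonempty_ball.2 hR, fun y hy ↦ starConvex_convexJoin (convex_ball _ _) hy⟩
  intro z hz
  obtain ⟨x, ⟨hxR, hxΩ⟩, y, hy, a, b, ha, hb, hab, rfl⟩ := mem_convexJoin.1 hz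
  have hxr : x ∈ ball x₀ r := ball_subset_ball (by nlinarith) hxR
  have hyr : y ∈ ball x₀ r := by
    rw [mem_ball] at hy ⊢
    have h1 := dist_triangle y (x₀ + h • e) x₀
    have h2 : dist (x₀ + h • e) x₀ = h := by
      rw [dist_eq_norm, add_sub_cancel_left, norm_smul, he, mul_one, Real.norm_of_nonneg]
      positivity
    nlinarith
  have hzr : a • x + b • y ∈ ball x₀ r := convex_ball x₀ r hxr hyr ha hb hab
  rw [hgΩ _ hzr]
  have hxg := (hgΩ x hxr).1 hxΩ
  -- The deviation of `y - x` from the vertical vector `h • e`.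
  set q : EuclideanSpace ℝ (Fin n) := (y - (x₀ + h • e)) - (x - x₀) with hq
  have hqn : ‖q‖ ≤ 2 * R := by
    rw [mem_ball_iff_norm] at hxR hy
    linarith [norm_sub_le (y - (x₀ + h • e)) (x - x₀)]
  have hy_eq : y = x + h • e + q := by rw [hq]; abel
  have hee : inner ℝ e e = (1 : ℝ) := by rw [real_inner_self_eq_norm_sq, he]; norm_num
  have hiq : |inner ℝ e q| ≤ ‖q‖ := by simpa [he] using abs_real_inner_le_norm e q
  have hinner : inner ℝ e (a • x + b • y) = inner ℝ e x + b * (h + inner ℝ e q) := by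
    rw [hy_eq]
    simp only [inner_add_right, inner_smul_right, hee]
    linear_combination (inner ℝ e x) * hab
  have hproj : (a • x + b • y - inner ℝ e (a • x + b • y) • e) - (x - inner ℝ e x • e) =
      b • (q - inner ℝ e q • e) := by
    rw [hinner, hy_eq, show a = 1 - b by linarith]
    module
  have hlip := hg.dist_le_mul (a • x + b • y - inner ℝ e (a • x + b • y) • e)
    (x - inner ℝ e x • e)
  rw [dist_eq_norm (a • x + b • y - _), hproj, norm_smul, Real.norm_of_nonneg hb,
    Real.dist_eq] at hlip
  have hPq : ‖q - inner ℝ e q • e‖ ≤ 4 * R := by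
    have h1 := norm_sub_le q (inner ℝ e q • e)
    rw [norm_smul, he, mul_one, Real.norm_eq_abs] at h1
    linarith
  have h5 : K * (b * ‖q - inner ℝ e q • e‖) ≤ b * (h + inner ℝ e q) := by
    have h6 : K * ‖q - inner ℝ e q • e‖ ≤ K * (4 * R) := by gcongr
    have h7 : K * ‖q - inner ℝ e q • e‖ ≤ h + inner ℝ e q := by
      have := (abs_le.1 (hiq.trans hqn)).1
      linarith
    calc K * (b * ‖q - inner ℝ e q • e‖) = b * (K * ‖q - inner ℝ e q • e‖) := by ring
      _ ≤ _ := by gcongr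
  rw [hinner] at *
  linarith [(abs_le.1 hlip).2]

/-! ### Comparing and gluing weak potentials -/

theorem IsWeakPotential.mono {n : ℕ} {U V : Set (EuclideanSpace ℝ (Fin n))}
    {v : EuclideanSpace ℝ (Fin n) → ℝ} {e : EuclideanSpace ℝ (Fin n) → Fin n → ℝ}
    (h : IsWeakPotential V v e) (hUV : U ⊆ V) : IsWeakPotential U v e :=
  fun φ hφ i ↦ h φ (hφ.mono hUV) i

theorem SobolevPoincare.IsTestFunction.integrable_mul_partialDeriv {n : ℕ}
    {U : Set (EuclideanSpace ℝ (Fin n))} {v φ : EuclideanSpace ℝ (Fin n) → ℝ}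
    (hφ : IsTestFunction ⊤ U φ) (hv : IntegrableOn v U) (hU : MeasurableSet U) (i : Fin n) :
    Integrable fun x ↦ v x * partialDeriv i φ x := by
  refine (((integrable_indicator_iff hU).2 hv).mul_continuous_of_hasCompactSupport
    (hφ.continuous_partialDeriv i) (hφ.hasCompactSupport_partialDeriv i)).congr
    (Eventually.of_forall fun x ↦ ?_)
  by_cases hx : x ∈ U
  · simp [hx]
  · simp [hφ.partialDeriv_eq_zero_of_notMem i hx]

theorem IsWeakPotential.exists_sub_ae_eq_const {n : ℕ} {U : Set (EuclideanSpace ℝ (Fin n))}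
    {v v' : EuclideanSpace ℝ (Fin n) → ℝ} {e : EuclideanSpace ℝ (Fin n) → Fin n → ℝ}
    (hU : IsOpen U) (hv : IntegrableOn v U) (hv' : IntegrableOn v' U)
    (h : IsWeakPotential U v e) (h' : IsWeakPotential U v' e)
    {p : EuclideanSpace ℝ (Fin n)} (hp : p ∈ U) :
    ∃ c, ∃ ρ > 0, ball p ρ ⊆ U ∧ ∀ᵐ x, x ∈ ball p ρ → v x - v' x = c := by
  obtain ⟨r, hr, hrU⟩ := Metric.isOpen_iff.1 hU p hp
  have hr2 : 2 * (r / 2) = r := by ring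
  obtain ⟨c, hc⟩ := ae_eq_const_of_weakGradient_eq_zero (w := U.indicator fun x ↦ v x - v' x)
    (x₀ := p) ((integrable_indicator_iff hU.measurableSet).2 (hv.sub hv')) (half_pos hr)
    (fun φ hφ i ↦ by
      rw [hr2] at hφ
      have hφU := hφ.mono hrU
      have h1 : ∀ x, U.indicator (fun x ↦ v x - v' x) x * partialDeriv i φ x =
          v x * partialDeriv i φ x - v' x * partialDeriv i φ x := fun x ↦ by
        by_cases hx : x ∈ U
        · simp [hx, sub_mul]
        · simp [hφU.partialDeriv_eq_zero_of_notMem i hx]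
      simp_rw [h1]
      rw [integral_sub (hφU.integrable_mul_partialDeriv hv hU.measurableSet i)
        (hφU.integrable_mul_partialDeriv hv' hU.measurableSet i), h φ hφU, h' φ hφU, sub_self])
  have hsub : ball p (r / 2) ⊆ U := (ball_subset_ball (by linarith)).trans hrU
  refine ⟨c, r / 2, half_pos hr, hsub, ?_⟩
  filter_upwards [hc] with x hx hxb
  rw [← hx hxb, indicator_of_mem (hsub hxb)]

theorem exists_mem_of_ae_imp {n : ℕ} {V : Set (EuclideanSpace ℝ (Fin n))} (hV : IsOpen V)
    (hne : V.Nonempty) {P : EuclideanSpace ℝ (Fin n) → Prop} (h : ∀ᵐ x, x ∈ V → P x) :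
    ∃ x ∈ V, P x := by
  by_contra! hcon
  refine (hV.measure_pos volume hne).ne' (measure_mono_null (fun x hx ↦ ?_) (ae_iff.1 h))
  exact fun hP ↦ hcon x hx (hP hx)

/-- On a simply connected set, potentials on connected open pieces can be shifted by constants so
that they agree on the overlaps. -/
theorem exists_shifts_of_isWeakPotential {n : ℕ} {Ω : Set (EuclideanSpace ℝ (Fin n))}
    (hΩo : IsOpen Ω) (hsc : IsSimplyConnected Ω) {e : EuclideanSpace ℝ (Fin n) → Fin n → ℝ}
    {ι : Type*} (U : ι → Set (EuclideanSpace ℝ (Fin n))) (hUo : ∀ i, IsOpen (U i))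
    (hUc : ∀ i, IsPreconnected (U i)) (hUΩ : ∀ i, U i ⊆ Ω) (hcov : ∀ x ∈ Ω, ∃ i, x ∈ U i)
    (v : ι → EuclideanSpace ℝ (Fin n) → ℝ) (hv : ∀ i, IntegrableOn (v i) (U i))
    (hpot : ∀ i, IsWeakPotential (U i) (v i) e) :
    ∃ a : ι → ℝ, ∀ i j, ∀ᵐ x, x ∈ U i ∩ U j → v i x + a i = v j x + a j := by
  -- Overlaps need not be connected, so the constant depends on the point `p`; off the overlap it
  -- takes the irrelevant value 0.
  have hdiff : ∀ i j p, ∃ c, p ∈ U i ∩ U j → ∃ ρ > 0, ball p ρ ⊆ U i ∩ U j ∧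
      ∀ᵐ x, x ∈ ball p ρ → v i x - v j x = c := by
    intro i j p
    by_cases hp : p ∈ U i ∩ U j
    · obtain ⟨c, hc⟩ := IsWeakPotential.exists_sub_ae_eq_const ((hUo i).inter (hUo j))
        ((hv i).mono_set inter_subset_left) ((hv j).mono_set inter_subset_right)
        ((hpot i).mono inter_subset_left) ((hpot j).mono inter_subset_right) hp
      exact ⟨c, fun _ ↦ hc⟩
    · exact ⟨0, fun h ↦ absurd h hp⟩
  choose c hc using hdiff
  have hclc : ∀ i j, ∀ p ∈ U i ∩ U j, ∀ᶠ q in 𝓝 p, c i j q = c i j p := by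
    intro i j p hp
    obtain ⟨ρ, hρ, hρU, hae⟩ := hc i j p hp
    filter_upwards [ball_mem_nhds p hρ] with q hq
    obtain ⟨ρ', hρ', -, hae'⟩ := hc i j q (hρU hq)
    -- Both constants equal `v i - v j` almost everywhere on a nonempty open set, which has positive
    -- measure, so they coincide. The cocycle identity follows in the same way.
    have h1 : ∀ᵐ x, x ∈ ball p ρ ∩ ball q ρ' → c i j q = c i j p := by
      filter_upwards [hae, hae'] with x h h' hx
      rw [← h hx.1, ← h' hx.2]
    obtain ⟨-, -, h2⟩ := exists_mem_of_ae_imp (isOpen_ball.inter isOpen_ball)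
      ⟨q, hq, mem_ball_self hρ'⟩ h1
    exact h2
  have hcocycle : ∀ i j k, ∀ p ∈ U i ∩ U j ∩ U k, c i j p + c j k p = c i k p := by
    intro i j k p hp
    obtain ⟨ρ₁, hρ₁, -, h₁⟩ := hc i j p hp.1
    obtain ⟨ρ₂, hρ₂, -, h₂⟩ := hc j k p ⟨hp.1.2, hp.2⟩
    obtain ⟨ρ₃, hρ₃, -, h₃⟩ := hc i k p ⟨hp.1.1, hp.2⟩
    have h4 : ∀ᵐ x, x ∈ ball p ρ₁ ∩ ball p ρ₂ ∩ ball p ρ₃ → c i j p + c j k p = c i k p := by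
      filter_upwards [h₁, h₂, h₃] with x h₁ h₂ h₃ hx
      rw [← h₁ hx.1.1, ← h₂ hx.1.2, ← h₃ hx.2]
      ring
    obtain ⟨-, -, h5⟩ := exists_mem_of_ae_imp ((isOpen_ball.inter isOpen_ball).inter isOpen_ball)
      ⟨p, ⟨mem_ball_self hρ₁, mem_ball_self hρ₂⟩, mem_ball_self hρ₃⟩ h4
    exact h5
  have := hsc.simplyConnectedSpace
  have := hΩo.locallyPathConnectedSpace
  obtain ⟨a, haloc, hac⟩ := exists_primitive_of_locallyConstant_cocycle (X := Ω)
    (fun i ↦ Subtype.val ⁻¹' U i) (fun i ↦ (hUo i).preimage continuous_subtype_val)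
    (fun x ↦ hcov x x.2) (fun i j x ↦ c i j x)
    (fun i j x hx ↦ continuous_subtype_val.continuousAt.eventually (hclc i j x hx))
    (fun i j k x hx ↦ hcocycle i j k x hx)
  -- Connectedness of the pieces turns locally constant shifts into constants.
  have hconst : ∀ i, ∃ α, ∀ x (hx : x ∈ U i), a i ⟨x, hUΩ i hx⟩ = α := by
    intro i
    have := isPreconnected_iff_preconnectedSpace.1 (hUc i)
    have hloc : IsLocallyConstant fun z : U i ↦ a i (inclusion (hUΩ i) z) :=
      (IsLocallyConstant.iff_eventually_eq _).2 fun z ↦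
        (continuous_inclusion (hUΩ i)).continuousAt.eventually (haloc i _ z.2)
    obtain h | ⟨x₁, hx₁⟩ := (U i).eq_empty_or_nonempty
    · exact ⟨0, fun x hx ↦ by simp [h] at hx⟩
    · exact ⟨a i ⟨x₁, hUΩ i hx₁⟩, fun x hx ↦
        hloc.apply_eq_of_preconnectedSpace ⟨x, hx⟩ ⟨x₁, hx₁⟩⟩
  choose α hα using hconst
  refine ⟨α, fun i j ↦ ?_⟩
  rw [ae_iff]
  refine measure_null_of_locally_null _ fun x hx ↦ ?_
  have hxU : x ∈ U i ∩ U j := (Classical.not_imp.1 hx).1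
  obtain ⟨ρ, hρ, -, hae⟩ := hc i j x hxU
  refine ⟨_, inter_mem_nhdsWithin _ (ball_mem_nhds x hρ), ?_⟩
  refine measure_mono_null (fun z hz ↦ ?_) (ae_iff.1 hae)
  refine fun hz' ↦ hz.1 fun _ ↦ ?_
  have h1 : a j ⟨x, _⟩ = a i ⟨x, _⟩ + c i j x := hac i j ⟨x, hUΩ i hxU.1⟩ hxU
  rw [hα i x hxU.1, hα j x hxU.2] at h1
  linarith [hz' hz.2]

/-- A partition of unity on the support of `φ` splits `φ` into test functions on the pieces. -/
theorem IsWeakPotential.of_finite_cover {n : ℕ} {Ω : Set (EuclideanSpace ℝ (Fin n))}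
    {v : EuclideanSpace ℝ (Fin n) → ℝ} {e : EuclideanSpace ℝ (Fin n) → Fin n → ℝ}
    (hv : IntegrableOn v Ω) (he : ∀ i, Integrable fun x ↦ e x i) (hΩ : IsOpen Ω)
    {ι : Type*} [Fintype ι] (U : ι → Set (EuclideanSpace ℝ (Fin n))) (hUo : ∀ i, IsOpen (U i))
    (hcov : Ω ⊆ ⋃ i, U i) (hpot : ∀ i, IsWeakPotential (U i) v e) : IsWeakPotential Ω v e := by
  intro φ hφ i
  obtain ⟨f, hf⟩ := SmoothPartitionOfUnity.exists_isSubordinate 𝓘(ℝ, EuclideanSpace ℝ (Fin n))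
    (isClosed_tsupport φ) U hUo (hφ.3.trans hcov)
  have hfs : ∀ k, ContDiff ℝ ∞ (f k) := fun k ↦ (f k).contMDiff.contDiff
  have hΩtest : ∀ k, IsTestFunction ⊤ Ω fun x ↦ f k x * φ x := fun k ↦ hφ.mul_left (hfs k)
  have htest : ∀ k, IsTestFunction ⊤ (U k) fun x ↦ f k x * φ x := fun k ↦
    ⟨(hΩtest k).1, (hΩtest k).2, (tsupport_mul_subset_left).trans (hf k)⟩
  have hsum : φ = fun x ↦ ∑ k, f k x * φ x := by
    ext x
    by_cases hx : x ∈ tsupport φ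
    · rw [← Finset.sum_mul, ← finsum_eq_sum_of_fintype, f.sum_eq_one hx, one_mul]
    · simp [image_eq_zero_of_notMem_tsupport hx]
  have hsumD : ∀ x, partialDeriv i φ x = ∑ k, partialDeriv i (fun x ↦ f k x * φ x) x := fun x ↦ by
    conv_lhs => rw [hsum]
    rw [partialDeriv, fderiv_fun_sum fun k _ ↦ (htest k).differentiable x]
    simp [partialDeriv]
  have h1 : ∫ x, v x * partialDeriv i φ x =
      ∑ k, ∫ x, v x * partialDeriv i (fun x ↦ f k x * φ x) x := by
    rw [← integral_finsetSum _ fun k _ ↦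
      (hΩtest k).integrable_mul_partialDeriv hv hΩ.measurableSet i]
    simp_rw [hsumD, Finset.mul_sum]
  have h2 : ∫ x, e x i * φ x = ∑ k, ∫ x, e x i * (f k x * φ x) := by
    rw [← integral_finsetSum _ fun k _ ↦
      (he i).mul_continuous_of_hasCompactSupport (htest k).1.continuous (htest k).2]
    simp_rw [← Finset.mul_sum]
    conv_lhs => rw [hsum]
  rw [h1, h2, ← Finset.sum_neg_distrib]
  exact Finset.sum_congr rfl fun k _ ↦ hpot k _ (htest k) i

theorem IsWeakPotential.add_const {n : ℕ} {U : Set (EuclideanSpace ℝ (Fin n))}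
    {v : EuclideanSpace ℝ (Fin n) → ℝ} {e : EuclideanSpace ℝ (Fin n) → Fin n → ℝ}
    (h : IsWeakPotential U v e) (hv : IntegrableOn v U) (hU : MeasurableSet U) (c : ℝ) :
    IsWeakPotential U (fun x ↦ v x + c) e := by
  intro φ hφ i
  have hint : Integrable fun x ↦ fderiv ℝ φ x (EuclideanSpace.single i 1) :=
    (hφ.continuous_partialDeriv i).integrable_of_hasCompactSupport
    (μ := volume) (hφ.hasCompactSupport_partialDeriv i)
  have h1 : ∫ x, partialDeriv i φ x = 0 := by
    simpa [partialDeriv] using integral_mul_fderiv_eq_neg_fderiv_mul_of_integrable (μ := volume)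
      (f := fun _ ↦ (1 : ℝ)) (g := φ) (v := EuclideanSpace.single i 1) (by simp)
      (by simpa using hint)
      (by simpa using hφ.1.continuous.integrable_of_hasCompactSupport (μ := volume) hφ.2)
      (fun _ _ ↦ by fun_prop) (fun x _ ↦ hφ.differentiable x)
  simp_rw [add_mul]
  rw [integral_add (hφ.integrable_mul_partialDeriv hv hU i)
    (Integrable.const_mul (f := partialDeriv i φ) hint c), integral_const_mul, h1, mul_zero,
    add_zero, h φ hφ i]

theorem IsWeakPotential.congr_ae {n : ℕ} {U : Set (EuclideanSpace ℝ (Fin n))}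
    {v v' : EuclideanSpace ℝ (Fin n) → ℝ} {e : EuclideanSpace ℝ (Fin n) → Fin n → ℝ}
    (h : IsWeakPotential U v e) (hv : ∀ᵐ x, x ∈ U → v' x = v x) : IsWeakPotential U v' e := by
  intro φ hφ i
  rw [← h φ hφ i]
  refine integral_congr_ae ?_
  filter_upwards [hv] with x hx
  by_cases hxU : x ∈ U
  · rw [hx hxU]
  · simp [hφ.partialDeriv_eq_zero_of_notMem i hxU]

/-! ### The global potential -/

theorem SobolevPoincare.IsBoundedLipschitzDomain.exists_isWeakPotential {n : ℕ}
    {Ω : Set (EuclideanSpace ℝ (Fin n))} (hΩ : IsBoundedLipschitzDomain Ω)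
    (hsc : IsSimplyConnected Ω) {e : EuclideanSpace ℝ (Fin n) → Fin n → ℝ}
    (hem : ∀ i, Measurable fun x ↦ e x i) (he : ∀ i, Integrable fun x ↦ e x i)
    (hcurl : ∀ φ, IsTestFunction 1 Ω φ → ∀ i j,
      ∫ x, (e x i * partialDeriv j φ x - e x j * partialDeriv i φ x) = 0) :
    ∃ v, IntegrableOn v Ω ∧ IsWeakPotential Ω v e := by
  have hloc : ∀ x : closure Ω, ∃ R > 0, ∃ U ⊆ Ω, IsOpen U ∧ ball (x : EuclideanSpace ℝ (Fin n)) R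
      ∩ Ω ⊆ U ∧ IsPreconnected U ∧ ∃ v, IntegrableOn v U ∧ IsWeakPotential U v e := by
    intro x
    obtain ⟨R, hR, U, hUΩ, hUo, hball, B, hBo, hBb, hBne, hstar⟩ := hΩ.exists_starConvex x.2
    refine ⟨R, hR, U, hUΩ, hUo, hball, ?_, exists_weakPotential_of_starConvex hUo
      (hΩ.isBounded.subset hUΩ) hBo hBb hBne hstar hem he
      fun φ hφ ↦ hcurl φ (hφ.mono hUΩ)⟩
    obtain ⟨y, hy⟩ := hBne
    obtain h | h := U.eq_empty_or_nonempty
    · rw [h]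
      exact isPreconnected_empty
    · exact ((hstar y hy).isPathConnected ((hstar y hy).mem h)).isConnected.isPreconnected
  choose R hR U hUΩ hUo hball hUc v hv hpot using hloc
  obtain ⟨t, ht⟩ := hΩ.isBounded.isCompact_closure.elim_finite_subcover
    (fun x : closure Ω ↦ ball (x : EuclideanSpace ℝ (Fin n)) (R x)) (fun _ ↦ isOpen_ball)
    (fun x hx ↦ mem_iUnion.2 ⟨⟨x, hx⟩, mem_ball_self (hR _)⟩)
  have hcov : ∀ x ∈ Ω, ∃ i : t, x ∈ U i := fun x hx ↦ by
    obtain ⟨i, hi, hxi⟩ := mem_iUnion₂.1 (ht (subset_closure hx))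
    exact ⟨⟨i, hi⟩, hball i ⟨hxi, hx⟩⟩
  obtain ⟨a, ha⟩ := exists_shifts_of_isWeakPotential hΩ.isOpen hsc (fun i : t ↦ U i)
    (fun i ↦ hUo i) (fun i ↦ hUc i) (fun i ↦ hUΩ i) hcov (fun i ↦ v i) (fun i ↦ hv i)
    (fun i ↦ hpot i)
  have : Nonempty t := ⟨(hcov _ hΩ.isConnected.nonempty.some_mem).choose⟩
  choose! idx hidx using hcov
  -- The choice of `idx` is arbitrary and need not be measurable: up to null sets, every piece
  -- containing `x` gives the same value.
  let V : EuclideanSpace ℝ (Fin n) → ℝ := fun x ↦ v (idx x) x + a (idx x)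
  have hV : ∀ i : t, ∀ᵐ x, x ∈ U i → V x = v i x + a i := by
    intro i
    filter_upwards [ae_all_iff.2 fun j ↦ ha j i] with x hx hxi
    exact hx (idx x) ⟨hidx x (hUΩ i hxi), hxi⟩
  have hshift : ∀ i : t, IntegrableOn (fun x ↦ v i x + a i) (U i) := fun i ↦
    (hv i).add (integrableOn_const (hΩ.isBounded.subset (hUΩ i)).measure_lt_top.ne)
  have hVint : IntegrableOn V Ω := by
    refine IntegrableOn.mono_set (t := ⋃ i : t, U i) (integrableOn_finite_iUnion.2 fun i ↦ ?_)
      fun x hx ↦ mem_iUnion.2 ⟨idx x, hidx x hx⟩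
    exact (hshift i).congr ((ae_restrict_iff' (hUo i).measurableSet).2
      ((hV i).mono fun x hx hxi ↦ (hx hxi).symm))
  exact ⟨V, hVint, IsWeakPotential.of_finite_cover hVint he hΩ.isOpen (fun i : t ↦ U i)
    (fun i ↦ hUo i) (fun x hx ↦ mem_iUnion.2 ⟨idx x, hidx x hx⟩)
    fun i ↦ ((hpot i).add_const (hv i) (hUo i).measurableSet (a i)).congr_ae (hV i)⟩

theorem SobolevPoincare.IsBoundedLipschitzDomain.exists_potential {n : ℕ}
    {Ω : Set (EuclideanSpace ℝ (Fin n))} (hΩ : IsBoundedLipschitzDomain Ω)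
    (hsc : IsSimplyConnected Ω) {e : EuclideanSpace ℝ (Fin n) → Fin n → ℝ}
    (he : ∀ i, IntegrableOn (fun x ↦ e x i) Ω) (hcurl : IsDistribCurlFree Ω e) :
    ∃ v, IntegrableOn v Ω ∧ ∀ φ, IsTestFunction ⊤ Ω φ → ∀ i,
      ∫ x in Ω, v x * partialDeriv i φ x = -∫ x in Ω, e x i * φ x := by
  have hΩm := hΩ.isOpen.measurableSet
  -- A Borel representative extended by zero: composition with the dilations needs true
  -- measurability, and the integrals then range over the whole space.
  let e' : EuclideanSpace ℝ (Fin n) → Fin n → ℝ := fun x i ↦ Ω.indicator ((he i).1.mk _) x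
  have hae : ∀ i, ∀ᵐ x ∂(volume.restrict Ω), e' x i = e x i := fun i ↦ by
    filter_upwards [(he i).1.ae_eq_mk, ae_restrict_mem hΩm] with x hx hxΩ
    simp [e', hxΩ, hx]
  have hem : ∀ i, Measurable fun x ↦ e' x i := fun i ↦
    (he i).1.measurable_mk.indicator hΩm
  have hei : ∀ i, Integrable fun x ↦ e' x i := fun i ↦
    (integrable_indicator_iff hΩm).2 ((he i).congr (he i).1.ae_eq_mk)
  have hzero : ∀ i x, x ∉ Ω → e' x i = 0 := fun i x hx ↦ indicator_of_notMem hx _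
  obtain ⟨v, hv, hpot⟩ := hΩ.exists_isWeakPotential hsc hem hei fun φ hφ i j ↦ by
    rw [← hcurl φ hφ i j, ← setIntegral_eq_integral_of_forall_compl_eq_zero (s := Ω)
      fun x hx ↦ by simp [hzero _ x hx]]
    refine integral_congr_ae ?_
    filter_upwards [hae i, hae j] with x hi hj
    rw [hi, hj]
  refine ⟨v, hv, fun φ hφ i ↦ ?_⟩
  rw [setIntegral_mul_eq_integral_mul fun x hx ↦ hφ.partialDeriv_eq_zero_of_notMem i hx,
    hpot φ hφ i, ← setIntegral_mul_eq_integral_mul (U := Ω)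
      fun x hx ↦ hφ.eq_zero_of_notMem hx]
  congr 1
  refine integral_congr_ae ?_
  filter_upwards [hae i] with x hx
  rw [hx]

theorem lemma2p4 {n N : ℕ} (Ω : Set (EuclideanSpace ℝ (Fin n)))
    (hΩ : IsBoundedLipschitzDomain Ω) (hsc : IsSimplyConnected Ω)
    (E : EuclideanSpace ℝ (Fin n) → Matrix (Fin N) (Fin n) ℝ)
    (hE : MatrixIntegrableOn Ω E) (hcurl : IsMatrixDistribCurlFree Ω E) :
    ∃ v : EuclideanSpace ℝ (Fin n) → EuclideanSpace ℝ (Fin N), MemW11 Ω v ∧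
      ∃ G : EuclideanSpace ℝ (Fin n) → Matrix (Fin N) (Fin n) ℝ,
        HasWeakGradient Ω v G ∧ ∀ᵐ x ∂(volume.restrict Ω), G x = E x := by
  choose v hv hgrad using fun α ↦ hΩ.exists_potential hsc (e := fun x i ↦ E x α i) (hE α) (hcurl α)
  have hV : IntegrableOn (fun x ↦ WithLp.toLp 2 fun α ↦ v α x : _ → EuclideanSpace ℝ (Fin N)) Ω :=
    Integrable.of_eval_piLp hv
  have hVE : HasWeakGradient Ω (fun x ↦ WithLp.toLp 2 fun α ↦ v α x) E :=
    ⟨hV.locallyIntegrableOn, fun α i ↦ (hE α i).locallyIntegrableOn,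
      fun φ hφ α i ↦ hgrad α φ hφ i⟩
  exact ⟨_, ⟨hV, E, hE, hVE⟩, E, hVE, Eventually.of_forall fun _ ↦ rfl⟩
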